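/- Let $\mathbb X$ be a compact metric space, $\mu$ a finite Borel measure on $\mathbb X$, $T\in\mathbb R$, and $\tau:\mathbb X\to[0,\infty)$ continuous. Let $\xi=(\xi(x))_{x\in\mathbb X}$ be a real Gaussian process with continuous sample paths on a probability space $(\Omega,\mathcal F,\mathbb P)$, seen as a random element of $C(\mathbb X)$, and let $(U_n)_{n\ge1}$ be i.i.d. $\mathcal N(0,1)$ variables, independent of $\xi$. For $\mathbb X$-valued $X_1,X_2,\dots$ put $Z_n=\xi(X_n)+\tau(X_n)U_n$ and $\mathcal F_n=\sigma(X_1,Z_1,\dots,X_n,Z_n)$. The sequence $(X_n)_{n\ge 1}$ is a sequential design if $X_{n+1}$ is $\mathcal F_{n}$-measurable for all $n\ge0$. Let $\mathbb P_n^\xi$ be the conditional distribution of $\xi$ given $\mathcal F_n$ and $\mathbb E_n=\mathbb E(\cdot\mid\mathcal F_n)$. For $f\in C(\mathbb X)$ let $\alpha(f)=\mu(\{u\in\mathbb X: f(u)\ge T\})$, and for a probability measure $\nu$ on $C(\mathbb X)$ let $\mathcal H(\nu)=\operatorname{Var}_{f\sim\nu}(\alpha(f))$. Let $\mathrm{Cond}_{x,z}(\nu)$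 be the conditional distribution of $f$ given $f(x)+\tau(x)u=z$, where $f\sim\nu$ and $u\sim\mathcal N(0,1)$ are independent, and put $$\mathcal J_x(\nu)=\iint \mathcal H\bigl(\mathrm{Cond}_{x,\,f(x)+u\tau(x)}(\nu)\bigr)\,\nu(\mathrm df)\,\phi(u)\,\mathrm du,\qquad J_n(x)=\mathcal J_x(\mathbb P_n^\xi),$$ where $\phi$ is the standard normal density. A sequential design is a SUR design for $\mathcal H$ if there is an integer $n_0$ such that, for all $n\ge n_0$, almost surely $X_{n+1}\in\operatorname{argmin}_{x\in\mathbb X} J_n(x)$. It is a quasi-SUR design for $\mathcal H$ if there are real numbers $\varepsilon_n>0$ with $\varepsilon_n\to0$ and an integer $n_0$ such that, for all $n\ge n_0$, almost surely $J_n(X_{n+1})\le\inf_{x\in\mathbb X} J_n(x)+\varepsilon_n$. Then, for every SUR design and every quasi-SUR design for $\mathcal H$, $\mathbb E_n(\alpha(\xi))\to\alpha(\xi)$ almost surely and in $L^1(\mathbb P)$ as $n\to\infty$. -/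

import Mathlib

open MeasureTheory ProbabilityTheory Filter Topology
open scoped ENNReal

namespace SUR

/-- The space of continuous functions carries its Borel σ-algebra. -/
instance instMeasurableSpaceContinuousMap {X : Type*} [TopologicalSpace X] :
    MeasurableSpace C(X, ℝ) :=
  borel _

instance instBorelSpaceContinuousMap {X : Type*} [TopologicalSpace X] : BorelSpace C(X, ℝ) :=
  ⟨rfl⟩

/-- Observations with heteroscedastic Gaussian noise. The sequences are indexed from zero:
`D n`, `U n`, `obs ξ τ D U n` are the design point, noise variable and observation
usually written `X_{n+1}`, `U_{n+1}`, `Z_{n+1} = ξ(X_{n+1}) + τ(X_{n+1}) U_{n+1}`. -/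
def obs {X Ω : Type*} [TopologicalSpace X] (ξ : Ω → C(X, ℝ)) (τ : X → ℝ) (D : ℕ → Ω → X)
    (U : ℕ → Ω → ℝ) (n : ℕ) (ω : Ω) : ℝ :=
  ξ ω (D n ω) + τ (D n ω) * U n ω

/-- The data available after `n` observations: the first `n` design points and observations. -/
def history {X Ω : Type*} [TopologicalSpace X] (ξ : Ω → C(X, ℝ)) (τ : X → ℝ) (D : ℕ → Ω → X)
    (U : ℕ → Ω → ℝ) (n : ℕ) (ω : Ω) : Fin n → X × ℝ :=
  fun i => (D i ω, obs ξ τ D U i ω)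

/-- The σ-algebra `ℱ_n` generated by the first `n` design points and observations. -/
abbrev obsSigma {X Ω : Type*} [TopologicalSpace X] [MeasurableSpace X] (ξ : Ω → C(X, ℝ))
    (τ : X → ℝ) (D : ℕ → Ω → X) (U : ℕ → Ω → ℝ) (n : ℕ) : MeasurableSpace Ω :=
  MeasurableSpace.comap (history ξ τ D U n) inferInstance

/-- A (non-randomized) sequential design: each design point is a measurable function of the
data already observed. -/
def IsSequentialDesign {X Ω : Type*} [TopologicalSpace X] [MeasurableSpace X]
    (ξ : Ω → C(X, ℝ)) (τ : X → ℝ) (D : ℕ → Ω → X) (U : ℕ → Ω → ℝ) : Prop :=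
  ∀ n, Measurable[obsSigma ξ τ D U n] (D n)

/-- The conditional distribution `P_n^ξ` of `ξ` given `ℱ_n`, as a random measure on the space of
continuous functions. -/
noncomputable def posterior {X Ω : Type*} [MetricSpace X] [CompactSpace X] [MeasurableSpace X]
    [MeasurableSpace Ω] (P : Measure Ω) [IsFiniteMeasure P] (ξ : Ω → C(X, ℝ))
    (τ : X → ℝ) (D : ℕ → Ω → X) (U : ℕ → Ω → ℝ) (n : ℕ) (ω : Ω) : Measure C(X, ℝ) :=
  condDistrib ξ (history ξ τ D U n) P (history ξ τ D U n ω)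

instance instIsProbabilityMeasurePosterior {X Ω : Type*} [MetricSpace X] [CompactSpace X]
    [MeasurableSpace X] [MeasurableSpace Ω] (P : Measure Ω)
    [IsFiniteMeasure P] (ξ : Ω → C(X, ℝ)) (τ : X → ℝ) (D : ℕ → Ω → X) (U : ℕ → Ω → ℝ) (n : ℕ)
    (ω : Ω) : IsProbabilityMeasure (posterior P ξ τ D U n ω) := by
  unfold posterior; infer_instance

/-- `Cond_{x,z}(ν)`: the conditional distribution of `f ∼ ν` given that the noisy evaluation
`f(x) + τ(x) u` equals `z`, where `u` is standard normal and independent of `f`. -/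
noncomputable def Cond {X : Type*} [MetricSpace X] [CompactSpace X] (τ : X → ℝ) (x : X) (z : ℝ)
    (ν : Measure C(X, ℝ)) [IsFiniteMeasure ν] : Measure C(X, ℝ) :=
  condDistrib (fun p : C(X, ℝ) × ℝ => p.1) (fun p : C(X, ℝ) × ℝ => p.1 x + τ x * p.2)
    (ν.prod (gaussianReal 0 1)) z

/-- The functional `𝒥_x(ν) = ∬ H(Cond_{x, f(x) + u τ(x)}(ν)) ν(df) φ(u) du`, with `φ` the standard
normal density: the expected value of the uncertainty functional `H` after one further noisy
evaluation at `x`. -/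
noncomputable def expectedUncertainty {X : Type*} [MetricSpace X] [CompactSpace X] (τ : X → ℝ)
    (H : Measure C(X, ℝ) → ℝ≥0∞) (x : X) (ν : Measure C(X, ℝ)) [IsFiniteMeasure ν] : ℝ≥0∞ :=
  ∫⁻ u, ∫⁻ f, H (Cond τ x (f x + τ x * u) ν) ∂ν ∂(gaussianReal 0 1)

/-- The sampling criterion `J_n(x) = 𝒥_x(P_n^ξ)`. -/
noncomputable def samplingCriterion {X Ω : Type*} [MetricSpace X] [CompactSpace X]
    [MeasurableSpace X] [MeasurableSpace Ω] (P : Measure Ω)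
    [IsFiniteMeasure P] (ξ : Ω → C(X, ℝ)) (τ : X → ℝ) (D : ℕ → Ω → X) (U : ℕ → Ω → ℝ)
    (H : Measure C(X, ℝ) → ℝ≥0∞) (n : ℕ) (x : X) (ω : Ω) : ℝ≥0∞ :=
  expectedUncertainty τ H x (posterior P ξ τ D U n ω)

/-- SUR sequential design for `H`: a sequential design which, from some deterministic step on,
almost surely minimizes the sampling criterion. -/
def IsSURDesign {X Ω : Type*} [MetricSpace X] [CompactSpace X] [MeasurableSpace X]
    [MeasurableSpace Ω] (P : Measure Ω) [IsFiniteMeasure P] (ξ : Ω → C(X, ℝ))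
    (τ : X → ℝ) (D : ℕ → Ω → X) (U : ℕ → Ω → ℝ) (H : Measure C(X, ℝ) → ℝ≥0∞) : Prop :=
  IsSequentialDesign ξ τ D U ∧
    ∃ n₀ : ℕ, ∀ n ≥ n₀, ∀ᵐ ω ∂P, ∀ x,
      samplingCriterion P ξ τ D U H n (D n ω) ω ≤ samplingCriterion P ξ τ D U H n x ω

/-- `ε`-quasi-SUR sequential design for `H`, where `ε` is a sequence of positive real numbers
tending to zero. -/
def IsQuasiSURDesign {X Ω : Type*} [MetricSpace X] [CompactSpace X] [MeasurableSpace X]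
    [MeasurableSpace Ω] (P : Measure Ω) [IsFiniteMeasure P] (ξ : Ω → C(X, ℝ))
    (τ : X → ℝ) (D : ℕ → Ω → X) (U : ℕ → Ω → ℝ) (H : Measure C(X, ℝ) → ℝ≥0∞) (ε : ℕ → ℝ) :
    Prop :=
  (∀ n, 0 < ε n) ∧ Tendsto ε atTop (𝓝 0) ∧ IsSequentialDesign ξ τ D U ∧
    ∃ n₀ : ℕ, ∀ n ≥ n₀, ∀ᵐ ω ∂P,
      samplingCriterion P ξ τ D U H n (D n ω) ω ≤
        (⨅ x, samplingCriterion P ξ τ D U H n x ω) + ENNReal.ofReal (ε n)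

/-- The excursion volume `α(f) = μ({u : f(u) ≥ T})`. -/
noncomputable def excursionVolume {X : Type*} [TopologicalSpace X] [MeasurableSpace X]
    (μ : Measure X) (T : ℝ) (f : C(X, ℝ)) : ℝ :=
  μ.real {u | T ≤ f u}

/-- The variance of excursion volume functional `ν ↦ Var_{f ∼ ν}(α(f))`. -/
noncomputable def excursionVariance {X : Type*} [TopologicalSpace X] [MeasurableSpace X]
    (μ : Measure X) (T : ℝ) (ν : Measure C(X, ℝ)) : ℝ≥0∞ :=
  evariance (excursionVolume μ T) ν

end SUR

/-!
Write `α` for the excursion volume, `ℱ_n` for the σ-algebra of the first `n` observations,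
`A_n = E(α(ξ) | ℱ_n)` and `V_n = E (α(ξ) - A_n)²`. By Lévy's upward theorem, `A_n` converges almost
surely and in `L¹` to `A = E(α(ξ) | ⋁ ℱ_n)`, so everything reduces to showing `A = α(ξ)` almost
surely, which is `SUR.excursionVolume_ae_eq_condExp`.

The criterion `𝒥_x(ν)` is the least mean squared error of a predictor of `α(f)` from one noisy
evaluation of `f ∼ ν` at `x`. Two consequences are used. The optimal predictor can be chosen jointly
measurable in `ν` and `x` (`SUR.exists_expectedUncertainty_eq`), so it is a function of the data
available after the next observation and `V_{n+1} ≤ E J_n(X_{n+1})`. In the other direction, the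
particular predictor `A_n + r ψ(ξ(x) + τ(x) u)`, with `|ψ| ≤ 1` and `u` a fresh standard normal
variable, gives
`E J_n(x) ≤ V_n - 2 r E[(α(ξ) - A_n) ψ(ξ(x) + τ(x) u)] + r²`. Since a (quasi-)SUR design satisfies
`J_n(X_{n+1}) ≤ J_n(x) + ε_n`, the two bounds combine to
`2 r E[(α(ξ) - A_n) ψ(ξ(x) + τ(x) u)] ≤ V_n - V_{n+1} + r² + ε_n`
(`SUR.two_mul_residual_correlation_le`). The sequence `V_n` is nonincreasing and nonnegative, so
letting `n → ∞` and then `r → 0`, for `ψ` and `-ψ`, shows that `α(ξ) - A` is orthogonal to every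
bounded function of `ξ(x) + τ(x) u` (`SUR.integral_residual_mul_noisy_eq_zero`).

With `ψ` a cosine or a sine, the noise contributes only a factor `exp (-t² τ(x)² / 2) ≠ 0`, and
uniqueness of characteristic functions shows that `α(ξ) - A` is orthogonal to the indicator of
`{T ≤ ξ(x)}`. Integrating over `x` with respect to `μ`, it is orthogonal to `α(ξ)`; being orthogonal
to `A` as well, it vanishes.
-/

namespace SUR

/-! ### Measurability on the space of continuous functions -/

section Measurability

lemma excursionVolume_nonneg {X : Type*} [TopologicalSpace X] [MeasurableSpace X] (μ : Measure X)
    (T : ℝ) (f : C(X, ℝ)) : 0 ≤ excursionVolume μ T f := measureReal_nonneg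

lemma excursionVolume_le {X : Type*} [TopologicalSpace X] [MeasurableSpace X] (μ : Measure X)
    [IsFiniteMeasure μ] (T : ℝ) (f : C(X, ℝ)) : excursionVolume μ T f ≤ μ.real Set.univ :=
  measureReal_mono (Set.subset_univ _)

lemma abs_excursionVolume_le {X : Type*} [TopologicalSpace X] [MeasurableSpace X] (μ : Measure X)
    [IsFiniteMeasure μ] (T : ℝ) (f : C(X, ℝ)) : |excursionVolume μ T f| ≤ μ.real Set.univ := by
  rw [abs_of_nonneg (excursionVolume_nonneg μ T f)]
  exact excursionVolume_le μ T f

variable {X : Type*} [MetricSpace X] [CompactSpace X]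

/-- Evaluations at a countable dense set embed `C(X, ℝ)` continuously and injectively into a
countable product, so by the Lusin–Souslin theorem they generate the Borel σ-algebra. -/
lemma measurable_continuousMap_of_eval {Ω : Type*} [MeasurableSpace Ω] {ξ : Ω → C(X, ℝ)}
    (h : ∀ x, Measurable fun ω => ξ ω x) : Measurable ξ := by
  obtain ⟨s, hs, hd⟩ := TopologicalSpace.exists_countable_dense X
  have := hs.to_subtype
  have hc : Continuous fun (f : C(X, ℝ)) (x : s) => f x := by fun_prop
  have hi : Function.Injective fun (f : C(X, ℝ)) (x : s) => f x := by
    intro f g hfg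
    refine DFunLike.coe_injective (Continuous.ext_on hd f.continuous g.continuous ?_)
    exact fun x hx => congrFun hfg ⟨x, hx⟩
  refine (hc.measurableEmbedding hi).measurable_comp_iff.1 ?_
  exact measurable_pi_lambda _ fun x => h x

variable [MeasurableSpace X] [BorelSpace X]

lemma measurable_eval : Measurable fun p : C(X, ℝ) × X => p.1 p.2 :=
  (by fun_prop : Continuous fun p : C(X, ℝ) × X => p.1 p.2).measurable

lemma measurable_excursionVolume (μ : Measure X) [IsFiniteMeasure μ] (T : ℝ) :
    Measurable (excursionVolume μ T) := by
  have hs : MeasurableSet {p : C(X, ℝ) × X | T ≤ p.1 p.2} :=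
    measurableSet_le measurable_const measurable_eval
  exact (measurable_measure_prodMk_left hs).ennreal_toReal

lemma measurable_noisyEval {τ : X → ℝ} (hτ : Measurable τ) :
    Measurable fun q : X × C(X, ℝ) × ℝ => q.2.1 q.1 + τ q.1 * q.2.2 :=
  (measurable_eval.comp (measurable_snd.fst.prodMk measurable_fst)).add
    ((hτ.comp measurable_fst).mul measurable_snd.snd)

end Measurability

/-! ### Conditional expectations as least-squares predictors -/

section CondExp

lemma ae_abs_condExp_le {Ω : Type*} {m m0 : MeasurableSpace Ω} {P : Measure Ω} {Y : Ω → ℝ} {C : ℝ}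
    (hC : ∀ ω, |Y ω| ≤ C) : ∀ᵐ ω ∂P, |(P[Y | m]) ω| ≤ C :=
  ae_bdd_abs_condExp_of_ae_bdd_abs (.of_forall hC)

variable {Ω : Type*} {m m0 : MeasurableSpace Ω} {P : Measure Ω} [IsProbabilityMeasure P]

lemma integrable_of_bound {f : Ω → ℝ} {C : ℝ} (hf : Measurable f) (hC : ∀ ω, |f ω| ≤ C) :
    Integrable f P :=
  Integrable.of_bound hf.aestronglyMeasurable C (.of_forall hC)

lemma integral_sub_condExp_mul_eq_zero (hm : m ≤ m0) {Y W : Ω → ℝ} {C K : ℝ}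
    (hY : Measurable Y) (hYC : ∀ ω, |Y ω| ≤ C) (hW : StronglyMeasurable[m] W)
    (hWK : ∀ᵐ ω ∂P, |W ω| ≤ K) : ∫ ω, (Y ω - (P[Y | m]) ω) * W ω ∂P = 0 := by
  have hYi : Integrable Y P := integrable_of_bound hY hYC
  have hi : Integrable (fun ω => Y ω - (P[Y | m]) ω) P := hYi.sub integrable_condExp
  have hmul : Integrable ((fun ω => Y ω - (P[Y | m]) ω) * W) P :=
    hi.mul_bdd (c := K) (hW.mono hm).aestronglyMeasurable hWK
  have h1 := condExp_mul_of_stronglyMeasurable_right hW hmul hi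
  have h2 : P[fun ω => Y ω - (P[Y | m]) ω | m] =ᵐ[P] 0 := by
    have h3 := condExp_sub hYi (integrable_condExp (f := Y) (μ := P) (m := m)) m
    rw [condExp_of_stronglyMeasurable hm stronglyMeasurable_condExp integrable_condExp] at h3
    filter_upwards [h3] with ω hω
    exact hω.trans (by simp)
  calc ∫ ω, (Y ω - (P[Y | m]) ω) * W ω ∂P
      = ∫ ω, (P[(fun ω => Y ω - (P[Y | m]) ω) * W | m]) ω ∂P := (integral_condExp hm).symm
    _ = ∫ ω, (0 : ℝ) ∂P := by
        refine integral_congr_ae ?_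
        filter_upwards [h1, h2] with ω h1 h2
        simp [h1, h2]
    _ = 0 := by simp

/-- Among bounded predictors measurable with respect to `m`, the conditional expectation minimizes
the mean squared error. -/
lemma integral_sq_sub_condExp_le (hm : m ≤ m0) {Y W : Ω → ℝ} {C K : ℝ}
    (hY : Measurable Y) (hYC : ∀ ω, |Y ω| ≤ C) (hW : StronglyMeasurable[m] W)
    (hWK : ∀ᵐ ω ∂P, |W ω| ≤ K) :
    ∫ ω, (Y ω - (P[Y | m]) ω) ^ 2 ∂P ≤ ∫ ω, (Y ω - W ω) ^ 2 ∂P := by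
  have hA : ∀ᵐ ω ∂P, |(P[Y | m]) ω| ≤ C := ae_abs_condExp_le hYC
  have hAm : Measurable (P[Y | m]) := (stronglyMeasurable_condExp.mono hm).measurable
  have hWm : Measurable W := (hW.mono hm).measurable
  have h0 := integral_sub_condExp_mul_eq_zero hm hY hYC
    (stronglyMeasurable_condExp.sub hW : StronglyMeasurable[m] (P[Y | m] - W)) (K := C + K) (by
      filter_upwards [hA, hWK] with ω h1 h2
      exact (abs_sub _ _).trans (add_le_add h1 h2))
  have hbd : ∀ {f g : Ω → ℝ} {a b : ℝ}, Measurable f → Measurable g → (∀ᵐ ω ∂P, |f ω| ≤ a) →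
      (∀ᵐ ω ∂P, |g ω| ≤ b) → Integrable (fun ω => f ω * g ω) P := by
    intro f g a b hf hg ha hb
    refine Integrable.of_bound (hf.mul hg).aestronglyMeasurable (a * b) ?_
    filter_upwards [ha, hb] with ω ha hb
    rw [Real.norm_eq_abs, abs_mul]
    exact mul_le_mul ha hb (abs_nonneg _) ((abs_nonneg _).trans ha)
  have hYA : ∀ᵐ ω ∂P, |Y ω - (P[Y | m]) ω| ≤ C + C := by
    filter_upwards [hA] with ω h1
    exact (abs_sub _ _).trans (add_le_add (hYC ω) h1)
  have hAW : ∀ᵐ ω ∂P, |(P[Y | m] - W) ω| ≤ C + K := by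
    filter_upwards [hA, hWK] with ω h1 h2
    exact (abs_sub _ _).trans (add_le_add h1 h2)
  have i1 := hbd (hY.sub hAm) (hY.sub hAm) hYA hYA
  have i2 := hbd (hY.sub hAm) (hAm.sub hWm) hYA hAW
  have i3 := hbd (hAm.sub hWm) (hAm.sub hWm) hAW hAW
  have key : ∫ ω, (Y ω - W ω) ^ 2 ∂P = ∫ ω, (Y ω - (P[Y | m]) ω) ^ 2 ∂P
      + 2 * ∫ ω, (Y ω - (P[Y | m]) ω) * (P[Y | m] - W) ω ∂P
      + ∫ ω, ((P[Y | m] - W) ω) ^ 2 ∂P := by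
    rw [← integral_const_mul, ← integral_add, ← integral_add]
    · refine integral_congr_ae (.of_forall fun ω => ?_)
      simp only [Pi.sub_apply]; ring
    · exact (i1.congr (.of_forall fun ω => by simp only [Pi.sub_apply]; ring)).add
        (i2.const_mul 2)
    · exact i3.congr (.of_forall fun ω => by simp only [Pi.sub_apply]; ring)
    · exact i1.congr (.of_forall fun ω => by simp only [Pi.sub_apply]; ring)
    · exact i2.const_mul 2
  rw [key, h0]
  have : 0 ≤ ∫ ω, ((P[Y | m] - W) ω) ^ 2 ∂P := integral_nonneg fun ω => sq_nonneg _
  linarith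

lemma lintegral_enorm_sq_eq {f : Ω → ℝ} {C : ℝ} (hf : Measurable f) (hC : ∀ᵐ ω ∂P, |f ω| ≤ C) :
    ∫⁻ ω, ‖f ω‖ₑ ^ 2 ∂P = ENNReal.ofReal (∫ ω, f ω ^ 2 ∂P) := by
  have hi : Integrable (fun ω => f ω ^ 2) P := by
    refine Integrable.of_bound (hf.pow_const 2).aestronglyMeasurable (C ^ 2) ?_
    filter_upwards [hC] with ω h
    rw [Real.norm_eq_abs, abs_pow]
    exact pow_le_pow_left₀ (abs_nonneg _) h 2
  rw [ofReal_integral_eq_lintegral_ofReal hi (.of_forall fun ω => sq_nonneg _)]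
  refine lintegral_congr fun ω => ?_
  rw [Real.enorm_eq_ofReal_abs, ← ENNReal.ofReal_pow (abs_nonneg _), sq_abs]

end CondExp

/-! ### Deconvolution of Gaussian noise -/

section Deconvolution

variable {Ω : Type*} [MeasurableSpace Ω] {P : Measure Ω} [IsProbabilityMeasure P]

/-- If two bounded nonnegative weights give every random variable `exp (i t Y)` the same mean,
then they give every event `{T ≤ Y}` the same mass. -/
lemma setIntegral_eq_of_charFun_eq {a b Y : Ω → ℝ} {C : ℝ} (ha : Measurable a) (hb : Measurable b)
    (ha0 : ∀ᵐ ω ∂P, 0 ≤ a ω) (hb0 : ∀ᵐ ω ∂P, 0 ≤ b ω) (haC : ∀ᵐ ω ∂P, a ω ≤ C)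
    (hbC : ∀ᵐ ω ∂P, b ω ≤ C) (hY : Measurable Y)
    (h : ∀ t : ℝ, ∫ ω, (a ω : ℂ) * Complex.exp (t * Y ω * Complex.I) ∂P =
      ∫ ω, (b ω : ℂ) * Complex.exp (t * Y ω * Complex.I) ∂P) (T : ℝ) :
    ∫ ω in {ω | T ≤ Y ω}, a ω ∂P = ∫ ω in {ω | T ≤ Y ω}, b ω ∂P := by
  have hint : ∀ {c : Ω → ℝ}, Measurable c → (∀ᵐ ω ∂P, 0 ≤ c ω) → (∀ᵐ ω ∂P, c ω ≤ C) →
      Integrable c P := by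
    intro c hc h0 h1
    refine Integrable.of_bound hc.aestronglyMeasurable C ?_
    filter_upwards [h0, h1] with ω h0 h1
    rwa [Real.norm_eq_abs, abs_of_nonneg h0]
  have hai := hint ha ha0 haC
  have hbi := hint hb hb0 hbC
  have hcf : ∀ {c : Ω → ℝ}, Measurable c → (∀ᵐ ω ∂P, 0 ≤ c ω) → ∀ t : ℝ,
      charFun ((P.withDensity fun ω => ENNReal.ofReal (c ω)).map Y) t =
        ∫ ω, (c ω : ℂ) * Complex.exp (t * Y ω * Complex.I) ∂P := by
    intro c hc h0 t
    rw [charFun_apply_real, integral_map hY.aemeasurable (by fun_prop),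
      integral_withDensity_eq_integral_toReal_smul (by fun_prop) (by simp)]
    refine integral_congr_ae ?_
    filter_upwards [h0] with ω h0
    rw [ENNReal.toReal_ofReal h0, Complex.real_smul]
  have hfa : IsFiniteMeasure (P.withDensity fun ω => ENNReal.ofReal (a ω)) :=
    isFiniteMeasure_withDensity_ofReal hai.2
  have hfb : IsFiniteMeasure (P.withDensity fun ω => ENNReal.ofReal (b ω)) :=
    isFiniteMeasure_withDensity_ofReal hbi.2
  have heq : (P.withDensity fun ω => ENNReal.ofReal (a ω)).map Y =
      (P.withDensity fun ω => ENNReal.ofReal (b ω)).map Y := by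
    refine Measure.ext_of_charFun (funext fun t => ?_)
    rw [hcf ha ha0, hcf hb hb0, h]
  have hs : MeasurableSet {ω | T ≤ Y ω} := measurableSet_le measurable_const hY
  have hmass : ∀ {c : Ω → ℝ}, Integrable c P → (∀ᵐ ω ∂P, 0 ≤ c ω) →
      ((P.withDensity fun ω => ENNReal.ofReal (c ω)).map Y) (Set.Ici T) =
        ENNReal.ofReal (∫ ω in {ω | T ≤ Y ω}, c ω ∂P) := by
    intro c hc h0
    rw [Measure.map_apply hY measurableSet_Ici, ofReal_integral_eq_lintegral_ofReal
      hc.integrableOn (ae_restrict_of_ae h0)]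
    exact withDensity_apply _ hs
  have h1 := congrArg (fun ν : Measure ℝ => ν (Set.Ici T)) heq
  simp only [hmass hai ha0, hmass hbi hb0] at h1
  exact (ENNReal.ofReal_eq_ofReal_iff (setIntegral_nonneg_of_ae ha0)
    (setIntegral_nonneg_of_ae hb0)).1 h1

/-- Gaussian noise can be deconvolved: a bounded weight which is orthogonal to every bounded
function of the noisy variable `Y + c u`, with `u` standard normal and independent, is orthogonal
to every `exp (i t Y)`, as the characteristic function of `c u` does not vanish. -/
lemma integral_mul_exp_eq_zero_of_noisy {a Y : Ω → ℝ} {C c : ℝ} (ha : Measurable a)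
    (haC : ∀ᵐ ω ∂P, |a ω| ≤ C) (hY : Measurable Y)
    (h : ∀ ψ : ℝ → ℝ, Measurable ψ → (∀ z, |ψ z| ≤ 1) →
      ∫ p : Ω × ℝ, a p.1 * ψ (Y p.1 + c * p.2) ∂(P.prod (gaussianReal 0 1)) = 0) (t : ℝ) :
    ∫ ω, (a ω : ℂ) * Complex.exp (t * Y ω * Complex.I) ∂P = 0 := by
  have haC' : ∀ᵐ p ∂(P.prod (gaussianReal 0 1)), |a p.1| ≤ C :=
    Measure.quasiMeasurePreserving_fst.ae haC
  have hint : ∀ ψ : ℝ → ℝ, Measurable ψ → (∀ z, |ψ z| ≤ 1) →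
      Integrable (fun p : Ω × ℝ => a p.1 * ψ (Y p.1 + c * p.2)) (P.prod (gaussianReal 0 1)) := by
    intro ψ hψ hψ1
    refine Integrable.of_bound (by fun_prop) C ?_
    filter_upwards [haC'] with p hp
    rw [Real.norm_eq_abs, abs_mul]
    exact (mul_le_of_le_one_right (abs_nonneg _) (hψ1 _)).trans hp
  have hcos := h (fun z => Real.cos (t * z)) (by fun_prop) fun z => Real.abs_cos_le_one _
  have hsin := h (fun z => Real.sin (t * z)) (by fun_prop) fun z => Real.abs_sin_le_one _
  have hprod : ∫ p : Ω × ℝ, ((a p.1 : ℂ) * Complex.exp (t * Y p.1 * Complex.I)) *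
      Complex.exp ((t * c : ℝ) * p.2 * Complex.I) ∂(P.prod (gaussianReal 0 1)) = 0 := by
    have hsplit : ∀ p : Ω × ℝ, ((a p.1 : ℂ) * Complex.exp (t * Y p.1 * Complex.I)) *
        Complex.exp ((t * c : ℝ) * p.2 * Complex.I) =
        ((a p.1 * Real.cos (t * (Y p.1 + c * p.2)) : ℝ) : ℂ) +
          ((a p.1 * Real.sin (t * (Y p.1 + c * p.2)) : ℝ) : ℂ) * Complex.I := by
      intro p
      have : Complex.exp (t * Y p.1 * Complex.I) * Complex.exp ((t * c : ℝ) * p.2 * Complex.I) =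
          Complex.exp ((t * (Y p.1 + c * p.2) : ℝ) * Complex.I) := by
        rw [← Complex.exp_add]; push_cast; ring_nf
      rw [mul_assoc, this, Complex.exp_mul_I]
      push_cast; ring
    simp_rw [hsplit]
    rw [integral_add, integral_mul_const, integral_complex_ofReal, integral_complex_ofReal, hcos,
      hsin]
    · simp
    · exact (hint _ (by fun_prop) fun z => Real.abs_cos_le_one (t * z)).ofReal
    · exact (hint _ (by fun_prop) fun z => Real.abs_sin_le_one (t * z)).ofReal.mul_const _
  rw [integral_prod_mul (fun ω => (a ω : ℂ) * Complex.exp (t * Y ω * Complex.I))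
    (fun u : ℝ => Complex.exp ((t * c : ℝ) * u * Complex.I)), ← charFun_apply_real,
    charFun_gaussianReal] at hprod
  exact (mul_eq_zero.1 hprod).resolve_right (Complex.exp_ne_zero _)

end Deconvolution

/-! ### The expected uncertainty after one further observation as a least-squares error -/

lemma lintegral_lintegral_condDistrib {Q E S : Type*} [MeasurableSpace Q] [MeasurableSpace E]
    [StandardBorelSpace E] [Nonempty E] [MeasurableSpace S] {ρ : Measure Q} [IsFiniteMeasure ρ]
    {e : Q → S} {Y : Q → E} (he : Measurable e) (hY : Measurable Y) {F : S × E → ℝ≥0∞}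
    (hF : Measurable F) :
    ∫⁻ q, ∫⁻ f, F (e q, f) ∂(condDistrib Y e ρ (e q)) ∂ρ = ∫⁻ q, F (e q, Y q) ∂ρ := by
  rw [← lintegral_map (f := fun s => ∫⁻ f, F (s, f) ∂(condDistrib Y e ρ s))
    (hF.lintegral_kernel_prod_right') he, ← Measure.lintegral_compProd hF,
    compProd_map_condDistrib hY.aemeasurable, lintegral_map hF (he.prodMk hY)]

lemma measurable_noisyEval_apply {X : Type*} [TopologicalSpace X]
    [SecondCountableTopology C(X, ℝ)] {τ : X → ℝ} (x : X) :
    Measurable fun p : C(X, ℝ) × ℝ => p.1 x + τ x * p.2 := by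
  have h : Continuous fun p : C(X, ℝ) × ℝ => p.1 x + τ x * p.2 := by fun_prop
  exact h.measurable

lemma abs_integral_excursionVolume_le {X : Type*} [TopologicalSpace X] [MeasurableSpace X]
    (μ : Measure X) [IsFiniteMeasure μ] (T : ℝ) (ν : Measure C(X, ℝ)) [IsProbabilityMeasure ν] :
    |∫ f, excursionVolume μ T f ∂ν| ≤ μ.real Set.univ := by
  refine (norm_integral_le_of_norm_le_const (C := μ.real Set.univ)
    (.of_forall fun f => (Real.norm_eq_abs _).trans_le (abs_excursionVolume_le μ T f))).trans ?_
  simp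

section Criterion

variable {X : Type*} [MetricSpace X] [CompactSpace X] [MeasurableSpace X] [BorelSpace X]
  (μ : Measure X) [IsFiniteMeasure μ] (T : ℝ)

lemma measurable_integral_excursionVolume {S : Type*} [MeasurableSpace S]
    (K : Kernel S C(X, ℝ)) [IsSFiniteKernel K] :
    Measurable fun s => ∫ f, excursionVolume μ T f ∂(K s) :=
  ((measurable_excursionVolume μ T).stronglyMeasurable.integral_kernel).measurable

lemma measurable_excursionVariance {S : Type*} [MeasurableSpace S]
    (K : Kernel S C(X, ℝ)) [IsSFiniteKernel K] :
    Measurable fun s => excursionVariance μ T (K s) := by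
  have h : Measurable fun p : S × C(X, ℝ) =>
      ‖excursionVolume μ T p.2 - ∫ f, excursionVolume μ T f ∂(K p.1)‖ₑ ^ 2 :=
    ((((measurable_excursionVolume μ T).comp measurable_snd).sub
      ((measurable_integral_excursionVolume μ T K).comp measurable_fst)).enorm).pow_const 2
  exact h.lintegral_kernel_prod_right'

/-- The mean minimizes the mean squared error among constants. -/
lemma excursionVariance_le (ν : Measure C(X, ℝ)) [IsProbabilityMeasure ν] (c : ℝ) :
    excursionVariance μ T ν ≤ ∫⁻ f, ‖excursionVolume μ T f - c‖ₑ ^ 2 ∂ν := by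
  have hα := measurable_excursionVolume μ T (X := X)
  have hb : ∀ d : ℝ, ∀ᵐ f ∂ν, |excursionVolume μ T f - d| ≤ μ.real Set.univ + |d| := fun d =>
    .of_forall fun f => (abs_sub _ _).trans (by gcongr; exact abs_excursionVolume_le μ T f)
  -- The mean is the conditional expectation given the trivial σ-algebra.
  have hbot : (⊥ : MeasurableSpace C(X, ℝ)) ≤ instMeasurableSpaceContinuousMap := bot_le
  have h := integral_sq_sub_condExp_le (P := ν) hbot hα (abs_excursionVolume_le μ T)
    (W := fun _ => c) (K := |c|) stronglyMeasurable_const (.of_forall fun _ => le_rfl)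
  rw [condExp_bot] at h
  rw [excursionVariance, evariance, lintegral_enorm_sq_eq (hα.sub_const _) (hb _),
    lintegral_enorm_sq_eq (hα.sub_const _) (hb _)]
  exact ENNReal.ofReal_le_ofReal h

variable {τ : X → ℝ} (x : X) (ν : Measure C(X, ℝ)) [IsProbabilityMeasure ν]

lemma expectedUncertainty_eq_lintegral_prod :
    expectedUncertainty τ (excursionVariance μ T) x ν =
      ∫⁻ p : C(X, ℝ) × ℝ, excursionVariance μ T (Cond τ x (p.1 x + τ x * p.2) ν)
        ∂(ν.prod (gaussianReal 0 1)) := by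
  have h : Measurable fun p : C(X, ℝ) × ℝ =>
      excursionVariance μ T (Cond τ x (p.1 x + τ x * p.2) ν) :=
    (measurable_excursionVariance μ T (condDistrib (fun p : C(X, ℝ) × ℝ => p.1)
      (fun p : C(X, ℝ) × ℝ => p.1 x + τ x * p.2) (ν.prod (gaussianReal 0 1)))).comp
      (measurable_noisyEval_apply x)
  rw [lintegral_prod_symm _ h.aemeasurable]
  rfl

/-- The expected uncertainty is at most the mean squared error of any predictor of the excursion
volume from the noisy evaluation. -/
lemma expectedUncertainty_le {g : ℝ → ℝ} (hg : Measurable g) :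
    expectedUncertainty τ (excursionVariance μ T) x ν ≤
      ∫⁻ p : C(X, ℝ) × ℝ, ‖excursionVolume μ T p.1 - g (p.1 x + τ x * p.2)‖ₑ ^ 2
        ∂(ν.prod (gaussianReal 0 1)) := by
  have hF : Measurable fun q : ℝ × C(X, ℝ) => ‖excursionVolume μ T q.2 - g q.1‖ₑ ^ 2 :=
    ((((measurable_excursionVolume μ T).comp measurable_snd).sub
      (hg.comp measurable_fst)).enorm).pow_const 2
  rw [expectedUncertainty_eq_lintegral_prod, ← lintegral_lintegral_condDistrib
    (ρ := ν.prod (gaussianReal 0 1)) (measurable_noisyEval_apply x) measurable_fst hF]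
  refine lintegral_mono fun p => ?_
  have : IsProbabilityMeasure (Cond τ x (p.1 x + τ x * p.2) ν) := by
    unfold Cond; infer_instance
  exact excursionVariance_le μ T (Cond τ x (p.1 x + τ x * p.2) ν) (g (p.1 x + τ x * p.2))

/-- The joint law of the noisy evaluation at `x` and of `f ∼ κ s`, as a kernel in `(s, x)`. -/
noncomputable def noisyEvalKernel {S : Type*} [MeasurableSpace S] (τ : X → ℝ)
    (κ : Kernel S C(X, ℝ)) : Kernel (S × X) (ℝ × C(X, ℝ)) :=
  (Kernel.id ×ₖ ((κ.comap Prod.fst measurable_fst) ×ₖ Kernel.const _ (gaussianReal 0 1))).map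
    fun q : (S × X) × C(X, ℝ) × ℝ => (q.2.1 q.1.2 + τ q.1.2 * q.2.2, q.2.1)

lemma measurable_noisyEvalKernel_map {S : Type*} [MeasurableSpace S] (hτ : Measurable τ) :
    Measurable fun q : (S × X) × C(X, ℝ) × ℝ => (q.2.1 q.1.2 + τ q.1.2 * q.2.2, q.2.1) :=
  ((measurable_noisyEval hτ).comp (measurable_fst.snd.prodMk measurable_snd)).prodMk
    measurable_snd.fst

lemma isMarkovKernel_noisyEvalKernel {S : Type*} [MeasurableSpace S] (hτ : Measurable τ)
    (κ : Kernel S C(X, ℝ)) [IsMarkovKernel κ] : IsMarkovKernel (noisyEvalKernel τ κ) :=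
  Kernel.IsMarkovKernel.map _ (measurable_noisyEvalKernel_map hτ)

lemma noisyEvalKernel_apply {S : Type*} [MeasurableSpace S] (hτ : Measurable τ)
    (κ : Kernel S C(X, ℝ)) [IsMarkovKernel κ] (s : S) (x : X) :
    noisyEvalKernel τ κ (s, x) =
      ((κ s).prod (gaussianReal 0 1)).map fun p => (p.1 x + τ x * p.2, p.1) := by
  rw [noisyEvalKernel, Kernel.map_apply _ (measurable_noisyEvalKernel_map hτ), Kernel.prod_apply,
    Kernel.prod_apply, Kernel.id_apply, Kernel.comap_apply, Kernel.const_apply,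
    Measure.dirac_prod, Measure.map_map (measurable_noisyEvalKernel_map hτ) measurable_prodMk_left]
  rfl

/-- The expected uncertainty is the mean squared error of a predictor which depends measurably on
the prior `κ s`, on the evaluation point and on the observation. Joint measurability comes from
disintegrating `noisyEvalKernel` as a kernel rather than pointwise. -/
lemma exists_expectedUncertainty_eq {S : Type*} [MeasurableSpace S] (hτ : Measurable τ)
    (κ : Kernel S C(X, ℝ)) [IsMarkovKernel κ] :
    ∃ g : (S × X) × ℝ → ℝ, Measurable g ∧ (∀ q, |g q| ≤ μ.real Set.univ) ∧ ∀ s x,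
      expectedUncertainty τ (excursionVariance μ T) x (κ s) =
        ∫⁻ p : C(X, ℝ) × ℝ, ‖excursionVolume μ T p.1 - g ((s, x), p.1 x + τ x * p.2)‖ₑ ^ 2
          ∂((κ s).prod (gaussianReal 0 1)) := by
  have hM := isMarkovKernel_noisyEvalKernel hτ κ
  have hLa := noisyEvalKernel_apply hτ κ
  generalize noisyEvalKernel τ κ = L at hM hLa
  set g : (S × X) × ℝ → ℝ := fun q => ∫ f, excursionVolume μ T f ∂(L.condKernel q) with hgdef
  have hg : Measurable g := measurable_integral_excursionVolume μ T L.condKernel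
  refine ⟨g, hg, fun q => abs_integral_excursionVolume_le μ T _, fun s x => ?_⟩
  set ρ := (κ s).prod (gaussianReal 0 1)
  set e := fun p : C(X, ℝ) × ℝ => p.1 x + τ x * p.2
  have he : Measurable e := measurable_noisyEval_apply x
  -- For each fixed `(s, x)`, the disintegration of the kernel agrees almost everywhere with that of
  -- the measure, which is the one defining `Cond`.
  have hae := Kernel.condKernel_apply_eq_condKernel L (s, x)
  simp only [Kernel.fst_apply, hLa] at hae
  rw [Measure.map_map measurable_fst (he.prodMk measurable_fst)] at hae
  have hae' := ae_of_ae_map (μ := ρ) (f := e) he.aemeasurable hae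
  have hF : Measurable fun q : ℝ × C(X, ℝ) => ‖excursionVolume μ T q.2 - g ((s, x), q.1)‖ₑ ^ 2 :=
    ((((measurable_excursionVolume μ T).comp measurable_snd).sub
      (hg.comp (measurable_const.prodMk measurable_fst))).enorm).pow_const 2
  rw [expectedUncertainty_eq_lintegral_prod, ← lintegral_lintegral_condDistrib
    (ρ := ρ) he measurable_fst hF]
  refine lintegral_congr_ae ?_
  filter_upwards [hae'] with p hp
  have hC : L.condKernel ((s, x), e p) = condDistrib (fun p => p.1) e ρ (e p) := by
    rw [condDistrib, hp]
  rw [Cond, excursionVariance, evariance, hgdef]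
  simp only [hC]
  rfl

end Criterion

/-! ### The history of a sequential design and the next noise variable -/

lemma indepFun_prodMk_of_indepFun {Ω A B C : Type*} [MeasurableSpace Ω] [MeasurableSpace A]
    [MeasurableSpace B] [MeasurableSpace C] {P : Measure Ω} [IsProbabilityMeasure P]
    {f : Ω → A} {g : Ω → B} {h : Ω → C} (hf : Measurable f) (hg : Measurable g)
    (hh : Measurable h) (h1 : IndepFun f (fun ω => (g ω, h ω)) P) (h2 : IndepFun g h P) :
    IndepFun (fun ω => (f ω, g ω)) h P := by
  have h3 : IndepFun f g P := h1.comp measurable_id measurable_fst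
  rw [indepFun_iff_map_prod_eq_prod_map_map (by fun_prop) (by fun_prop)] at h1 h2 h3 ⊢
  have := Measure.isProbabilityMeasure_map hf.aemeasurable (μ := P)
  have := Measure.isProbabilityMeasure_map hg.aemeasurable (μ := P)
  have := Measure.isProbabilityMeasure_map hh.aemeasurable (μ := P)
  refine (MeasurableEquiv.prodAssoc (α := A) (β := B) (γ := C)).map_measurableEquiv_injective ?_
  rw [h3, Measure.prodAssoc_prod, ← h2, ← h1, Measure.map_map (by fun_prop) (by fun_prop)]
  rfl

section Design

lemma obsSigma_mono {X Ω : Type*} [TopologicalSpace X] [MeasurableSpace X] {ξ : Ω → C(X, ℝ)}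
    {τ : X → ℝ} {D : ℕ → Ω → X} {U : ℕ → Ω → ℝ} {m n : ℕ} (h : m ≤ n) :
    obsSigma ξ τ D U m ≤ obsSigma ξ τ D U n := by
  have hr : history ξ τ D U m =
      (fun v (i : Fin m) => v (⟨i, i.2.trans_le h⟩ : Fin n)) ∘ history ξ τ D U n := rfl
  rw [obsSigma, hr, ← MeasurableSpace.comap_comp]
  exact MeasurableSpace.comap_mono (Measurable.comap_le (by fun_prop))

variable {X Ω : Type*} [MetricSpace X] [CompactSpace X] [MeasurableSpace X]
  {ξ : Ω → C(X, ℝ)} {τ : X → ℝ} {U : ℕ → Ω → ℝ} {D : ℕ → Ω → X}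

/-- The history of a sequential design is a measurable function of the unknown function and of
the noise variables used so far. -/
lemma obsSigma_le_comap [BorelSpace X] (hτ : Measurable τ) (hD : IsSequentialDesign ξ τ D U)
    (n : ℕ) :
    obsSigma ξ τ D U n ≤
      MeasurableSpace.comap (fun ω => (ξ ω, fun i : Fin n => U i ω)) inferInstance := by
  induction n using Nat.strong_induction_on with
  | _ n ih =>
  let m : MeasurableSpace Ω :=
    MeasurableSpace.comap (fun ω => (ξ ω, fun i : Fin n => U i ω)) inferInstance
  have hpast : Measurable[m] fun ω => (ξ ω, fun i : Fin n => U i ω) := comap_measurable _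
  have hξ : Measurable[m] ξ := hpast.fst
  have hU : ∀ i : Fin n, Measurable[m] (U i) := fun i => (measurable_pi_apply i).comp hpast.snd
  have hDm : ∀ i : Fin n, Measurable[m] (D i) := by
    intro i
    refine (hD i).mono ((ih i i.2).trans ?_) le_rfl
    refine Measurable.comap_le (m₁ := m) (hξ.prodMk (measurable_pi_lambda _ fun j => ?_))
    exact hU ⟨j, j.2.trans i.2⟩
  refine Measurable.comap_le (m₁ := m) (measurable_pi_lambda _ fun i => (hDm i).prodMk ?_)
  exact (measurable_noisyEval hτ).comp ((hDm i).prodMk (hξ.prodMk (hU i)))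

variable [MeasurableSpace Ω] {P : Measure Ω} [IsProbabilityMeasure P]

lemma lintegral_posterior_prod (hξ : Measurable ξ) (n : ℕ)
    (hh : Measurable (history ξ τ D U n)) {F : (Fin n → X × ℝ) × C(X, ℝ) × ℝ → ℝ≥0∞}
    (hF : Measurable F) :
    ∫⁻ ω, ∫⁻ p, F (history ξ τ D U n ω, p) ∂((posterior P ξ τ D U n ω).prod (gaussianReal 0 1))
      ∂P = ∫⁻ q : Ω × ℝ, F (history ξ τ D U n q.1, ξ q.1, q.2) ∂(P.prod (gaussianReal 0 1)) := by
  have hF' : Measurable fun s : (Fin n → X × ℝ) × C(X, ℝ) =>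
      ∫⁻ u, F (s.1, s.2, u) ∂(gaussianReal 0 1) := by
    refine Measurable.lintegral_prod_right'
      (f := fun q : ((Fin n → X × ℝ) × C(X, ℝ)) × ℝ => F (q.1.1, q.1.2, q.2)) ?_
    fun_prop
  rw [lintegral_prod _ (by fun_prop), ← lintegral_lintegral_condDistrib hh hξ hF']
  refine lintegral_congr fun ω => ?_
  rw [lintegral_prod _ (by fun_prop)]
  rfl

/-- Given the history, the unknown function and the next noise variable are distributed as the
product of the posterior and the standard normal law. -/
lemma lintegral_posterior_prod_eq_noise (hξ : Measurable ξ) (n : ℕ)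
    (hh : Measurable (history ξ τ D U n)) (hU : Measurable (U n))
    (hU_law : P.map (U n) = gaussianReal 0 1)
    (hind : IndepFun (fun ω => (history ξ τ D U n ω, ξ ω)) (U n) P)
    {F : (Fin n → X × ℝ) × C(X, ℝ) × ℝ → ℝ≥0∞} (hF : Measurable F) :
    ∫⁻ ω, ∫⁻ p, F (history ξ τ D U n ω, p) ∂((posterior P ξ τ D U n ω).prod (gaussianReal 0 1))
      ∂P = ∫⁻ ω, F (history ξ τ D U n ω, ξ ω, U n ω) ∂P := by
  have hF' : Measurable fun q : ((Fin n → X × ℝ) × C(X, ℝ)) × ℝ => F (q.1.1, q.1.2, q.2) := by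
    fun_prop
  have h1 : (P.prod (gaussianReal 0 1)).map
      (fun q : Ω × ℝ => ((history ξ τ D U n q.1, ξ q.1), q.2)) =
      P.map fun ω => ((history ξ τ D U n ω, ξ ω), U n ω) := by
    have h := Measure.map_prod_map P (gaussianReal 0 1) (hh.prodMk hξ) measurable_id
    rw [Measure.map_id] at h
    rw [(indepFun_iff_map_prod_eq_prod_map_map (by fun_prop) (by fun_prop)).1 hind, hU_law, h]
    rfl
  rw [lintegral_posterior_prod hξ n hh hF]
  have h2 := congrArg (fun ν => ∫⁻ q, F (q.1.1, q.1.2, q.2) ∂ν) h1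
  rwa [lintegral_map hF' (by fun_prop), lintegral_map hF' (by fun_prop)] at h2

variable [BorelSpace X]

lemma measurable_history (hτ : Measurable τ) (hξ : Measurable ξ) (hU : ∀ n, Measurable (U n))
    (hD : IsSequentialDesign ξ τ D U) (n : ℕ) : Measurable (history ξ τ D U n) := by
  refine measurable_iff_comap_le.2 ((obsSigma_le_comap hτ hD n).trans ?_)
  exact Measurable.comap_le (hξ.prodMk (measurable_pi_lambda _ fun i => hU i))

/-- The next noise variable is independent of the unknown function and of the history. -/
lemma indepFun_history_noise (hτ : Measurable τ) (hξ : Measurable ξ)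
    (hU : ∀ n, Measurable (U n)) (hU_indep : iIndepFun U P)
    (hξU : IndepFun ξ (fun ω n => U n ω) P) (hD : IsSequentialDesign ξ τ D U) (n : ℕ) :
    IndepFun (fun ω => (history ξ τ D U n ω, ξ ω)) (U n) P := by
  have h1 : IndepFun ξ (fun ω => ((fun i : Fin n => U i ω), U n ω)) P :=
    hξU.comp (φ := id) (ψ := fun v : ℕ → ℝ => ((fun i : Fin n => v i), v n)) measurable_id
      (by fun_prop)
  have h2 : IndepFun (fun ω (i : Fin n) => U i ω) (U n) P :=
    (hU_indep.indepFun_finset (Finset.range n) {n} (by simp) hU).comp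
      (φ := fun v (i : Fin n) => v ⟨i, Finset.mem_range.2 i.2⟩)
      (ψ := fun v => v ⟨n, Finset.mem_singleton_self n⟩)
      (measurable_pi_lambda _ fun i => measurable_pi_apply _) (measurable_pi_apply _)
  have h3 : IndepFun (fun ω => (ξ ω, fun i : Fin n => U i ω)) (U n) P :=
    indepFun_prodMk_of_indepFun hξ (measurable_pi_lambda _ fun i => hU i) (hU n) h1 h2
  rw [IndepFun_iff_Indep] at h3 ⊢
  refine indep_of_indep_of_le_left h3 ?_
  let m : MeasurableSpace Ω :=
    MeasurableSpace.comap (fun ω => (ξ ω, fun i : Fin n => U i ω)) inferInstance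
  have hh : Measurable[m] (history ξ τ D U n) :=
    measurable_iff_comap_le.2 (obsSigma_le_comap hτ hD n)
  have hpast : Measurable[m] fun ω => (ξ ω, fun i : Fin n => U i ω) := comap_measurable _
  exact Measurable.comap_le (m₁ := m) (hh.prodMk hpast.fst)

end Design

/-! ### Decrease of the mean squared error along the design -/

section Step

variable {X Ω : Type*} [MetricSpace X] [CompactSpace X] [MeasurableSpace X]
  [MeasurableSpace Ω] {P : Measure Ω} [IsProbabilityMeasure P] {ξ : Ω → C(X, ℝ)}
  {τ : X → ℝ} {U : ℕ → Ω → ℝ} {D : ℕ → Ω → X} {μ : Measure X} [IsFiniteMeasure μ] {T : ℝ}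

/-- SUR and quasi-SUR designs alike minimize the criterion up to an error tending to zero. -/
lemma exists_almost_minimizing {H : Measure C(X, ℝ) → ℝ≥0∞}
    (hD : IsSURDesign P ξ τ D U H ∨ ∃ ε : ℕ → ℝ, IsQuasiSURDesign P ξ τ D U H ε) :
    IsSequentialDesign ξ τ D U ∧ ∃ ε : ℕ → ℝ, (∀ n, 0 ≤ ε n) ∧ Tendsto ε atTop (𝓝 0) ∧
      ∃ n₀ : ℕ, ∀ n ≥ n₀, ∀ᵐ ω ∂P, ∀ x, samplingCriterion P ξ τ D U H n (D n ω) ω ≤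
        samplingCriterion P ξ τ D U H n x ω + ENNReal.ofReal (ε n) := by
  rcases hD with ⟨hseq, n₀, h⟩ | ⟨ε, hpos, hε, hseq, n₀, h⟩
  · refine ⟨hseq, fun _ => 0, fun _ => le_rfl, tendsto_const_nhds, n₀, fun n hn => ?_⟩
    filter_upwards [h n hn] with ω hω x
    simpa using hω x
  · refine ⟨hseq, ε, fun n => (hpos n).le, hε, n₀, fun n hn => ?_⟩
    filter_upwards [h n hn] with ω hω x
    exact hω.trans (by gcongr; exact iInf_le _ x)

variable [BorelSpace X]

/-- The criterion at the chosen design point bounds the next mean squared error: the predictor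
whose error it measures is a function of the data available after the next observation. -/
lemma ofReal_integral_sq_le_lintegral_samplingCriterion (hτ : Measurable τ) (hξ : Measurable ξ)
    (hU : ∀ n, Measurable (U n)) (hU_law : ∀ n, P.map (U n) = gaussianReal 0 1)
    (hU_indep : iIndepFun U P) (hξU : IndepFun ξ (fun ω n => U n ω) P)
    (hD : IsSequentialDesign ξ τ D U) (n : ℕ) :
    ENNReal.ofReal (∫ ω, (excursionVolume μ T (ξ ω) -
        (P[fun ω' => excursionVolume μ T (ξ ω') | obsSigma ξ τ D U (n + 1)]) ω) ^ 2 ∂P) ≤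
      ∫⁻ ω, samplingCriterion P ξ τ D U (excursionVariance μ T) n (D n ω) ω ∂P := by
  have hh := measurable_history hτ hξ hU hD
  have hα : Measurable fun ω => excursionVolume μ T (ξ ω) :=
    (measurable_excursionVolume μ T).comp hξ
  -- `D n` is a measurable function `d` of the history, and `W` below is the optimal predictor
  -- evaluated at the data of step `n`.
  obtain ⟨ω₀⟩ := P.nonempty_of_neZero
  have : Nonempty X := ⟨D 0 ω₀⟩
  obtain ⟨d, hd, hDd⟩ := (hD n).exists_eq_measurable_comp
  obtain ⟨g, hg, hgb, hJ⟩ := exists_expectedUncertainty_eq μ T hτ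
    (condDistrib ξ (history ξ τ D U n) P)
  have hF : Measurable fun q : (Fin n → X × ℝ) × C(X, ℝ) × ℝ =>
      ‖excursionVolume μ T q.2.1 -
        g ((q.1, d q.1), q.2.1 (d q.1) + τ (d q.1) * q.2.2)‖ₑ ^ 2 := by
    refine (Measurable.enorm (Measurable.sub ?_ (hg.comp (Measurable.prodMk ?_ ?_)))).pow_const 2
    · exact (measurable_excursionVolume μ T).comp measurable_snd.fst
    · exact measurable_fst.prodMk (hd.comp measurable_fst)
    · exact (measurable_noisyEval hτ).comp ((hd.comp measurable_fst).prodMk measurable_snd)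
  have hlaw := lintegral_posterior_prod_eq_noise hξ n (hh n) (hU n) (hU_law n)
    (indepFun_history_noise hτ hξ hU hU_indep hξU hD n) hF
  have hDω : ∀ ω, d (history ξ τ D U n ω) = D n ω := fun ω => (congrFun hDd ω).symm
  have hJω : ∀ ω, samplingCriterion P ξ τ D U (excursionVariance μ T) n (D n ω) ω = _ :=
    fun ω => hJ (history ξ τ D U n ω) (D n ω)
  simp only [hDω] at hlaw
  set W : Ω → ℝ := fun ω => g ((history ξ τ D U n ω, D n ω), obs ξ τ D U n ω) with hWdef
  have hWm : StronglyMeasurable[obsSigma ξ τ D U (n + 1)] W := by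
    let m : MeasurableSpace Ω := obsSigma ξ τ D U (n + 1)
    have h0 : Measurable[m] (history ξ τ D U (n + 1)) := comap_measurable _
    have h1 : Measurable[m] (history ξ τ D U n) :=
      measurable_iff_comap_le.2 (obsSigma_mono n.le_succ)
    have h2 : Measurable[m] fun ω => (D n ω, obs ξ τ D U n ω) :=
      (measurable_pi_apply (Fin.last n)).comp h0
    exact (hg.comp ((h1.prodMk h2.fst).prodMk h2.snd)).stronglyMeasurable
  have hWm' : Measurable W := (hWm.mono (hh (n + 1)).comap_le).measurable
  calc _ ≤ ENNReal.ofReal (∫ ω, (excursionVolume μ T (ξ ω) - W ω) ^ 2 ∂P) :=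
        ENNReal.ofReal_le_ofReal <| integral_sq_sub_condExp_le (hh (n + 1)).comap_le hα
          (fun ω => abs_excursionVolume_le μ T _) hWm (.of_forall fun ω => hgb _)
    _ = ∫⁻ ω, ‖excursionVolume μ T (ξ ω) - W ω‖ₑ ^ 2 ∂P :=
        (lintegral_enorm_sq_eq (hα.sub hWm') (C := μ.real Set.univ + μ.real Set.univ)
          (.of_forall fun ω => (abs_sub _ _).trans
            (add_le_add (abs_excursionVolume_le μ T _) (hgb _)))).symm
    _ = _ := hlaw.symm
    _ = _ := lintegral_congr fun ω => (hJω ω).symm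

/-- The criterion at a fixed point is at most the mean squared error of any predictor which
corrects the current conditional expectation by a function of a fresh observation at that point. -/
lemma lintegral_samplingCriterion_le (hξ : Measurable ξ) (n : ℕ)
    (hh : Measurable (history ξ τ D U n)) (x : X) {ψ : ℝ → ℝ} (hψ : Measurable ψ)
    (hψ1 : ∀ z, |ψ z| ≤ 1) (r : ℝ) :
    ∫⁻ ω, samplingCriterion P ξ τ D U (excursionVariance μ T) n x ω ∂P ≤
      ENNReal.ofReal (∫ q : Ω × ℝ, ((excursionVolume μ T (ξ q.1) -
        (P[fun ω' => excursionVolume μ T (ξ ω') | obsSigma ξ τ D U n]) q.1) -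
          r * ψ (ξ q.1 x + τ x * q.2)) ^ 2 ∂(P.prod (gaussianReal 0 1))) := by
  have hα : Measurable fun ω => excursionVolume μ T (ξ ω) :=
    (measurable_excursionVolume μ T).comp hξ
  set κ := condDistrib ξ (history ξ τ D U n) P
  set a : (Fin n → X × ℝ) → ℝ := fun s => ∫ f, excursionVolume μ T f ∂(κ s) with hadef
  have ha : Measurable a := measurable_integral_excursionVolume μ T κ
  have hae : (P[fun ω' => excursionVolume μ T (ξ ω') | obsSigma ξ τ D U n]) =ᵐ[P]
      fun ω => a (history ξ τ D U n ω) :=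
    condExp_ae_eq_integral_condDistrib hh hξ.aemeasurable
      (measurable_excursionVolume μ T).stronglyMeasurable
      (integrable_of_bound hα fun ω => abs_excursionVolume_le μ T _)
  have hz : Measurable fun p : C(X, ℝ) × ℝ => p.1 x + τ x * p.2 := measurable_noisyEval_apply x
  have hF : Measurable fun q : (Fin n → X × ℝ) × C(X, ℝ) × ℝ =>
      ‖excursionVolume μ T q.2.1 - (a q.1 + r * ψ (q.2.1 x + τ x * q.2.2))‖ₑ ^ 2 := by
    refine (Measurable.enorm (Measurable.sub ?_ (Measurable.add ?_ ?_))).pow_const 2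
    · exact (measurable_excursionVolume μ T).comp measurable_snd.fst
    · exact ha.comp measurable_fst
    · exact (hψ.comp (hz.comp measurable_snd)).const_mul r
  have hG : Measurable fun q : Ω × ℝ => excursionVolume μ T (ξ q.1) -
      (a (history ξ τ D U n q.1) + r * ψ (ξ q.1 x + τ x * q.2)) :=
    (hα.comp measurable_fst).sub ((ha.comp (hh.comp measurable_fst)).add
      ((hψ.comp (hz.comp ((hξ.comp measurable_fst).prodMk measurable_snd))).const_mul r))
  calc _ ≤ ∫⁻ ω, ∫⁻ p : C(X, ℝ) × ℝ, ‖excursionVolume μ T p.1 -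
          (a (history ξ τ D U n ω) + r * ψ (p.1 x + τ x * p.2))‖ₑ ^ 2
          ∂((posterior P ξ τ D U n ω).prod (gaussianReal 0 1)) ∂P :=
        lintegral_mono fun ω => expectedUncertainty_le μ T x _
          (g := fun z => a (history ξ τ D U n ω) + r * ψ z) (by fun_prop)
    _ = _ := lintegral_posterior_prod hξ n hh hF
    _ = _ := lintegral_enorm_sq_eq hG
        (C := μ.real Set.univ + (μ.real Set.univ + |r|)) (.of_forall fun q => by
          refine (abs_sub _ _).trans (add_le_add (abs_excursionVolume_le μ T _)
            ((abs_add_le _ _).trans (add_le_add ?_ ?_)))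
          · exact abs_integral_excursionVolume_le μ T _
          · rw [abs_mul]
            exact mul_le_of_le_one_right (abs_nonneg _) (hψ1 _))
    _ = _ := by
        congr 1
        refine integral_congr_ae ?_
        filter_upwards [Measure.quasiMeasurePreserving_fst.ae hae] with q hq
        rw [hq, sub_sub]

/-- For an arbitrary test function of a noisy observation at `x`, the residual correlation is
controlled by the decrease of the mean squared error and the slack of the design. -/
lemma two_mul_residual_correlation_le (hτ : Measurable τ) (hξ : Measurable ξ)
    (hU : ∀ n, Measurable (U n)) (hU_law : ∀ n, P.map (U n) = gaussianReal 0 1)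
    (hU_indep : iIndepFun U P) (hξU : IndepFun ξ (fun ω n => U n ω) P)
    (hD : IsSequentialDesign ξ τ D U) (n : ℕ) {ε : ℝ} (hε : 0 ≤ ε) (x : X)
    (hmin : ∀ᵐ ω ∂P, samplingCriterion P ξ τ D U (excursionVariance μ T) n (D n ω) ω ≤
        samplingCriterion P ξ τ D U (excursionVariance μ T) n x ω + ENNReal.ofReal ε)
    {ψ : ℝ → ℝ} (hψ : Measurable ψ) (hψ1 : ∀ z, |ψ z| ≤ 1) (r : ℝ) :
    2 * r * ∫ q : Ω × ℝ, (excursionVolume μ T (ξ q.1) -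
        (P[fun ω' => excursionVolume μ T (ξ ω') | obsSigma ξ τ D U n]) q.1) *
          ψ (ξ q.1 x + τ x * q.2) ∂(P.prod (gaussianReal 0 1)) ≤
      ∫ ω, (excursionVolume μ T (ξ ω) -
        (P[fun ω' => excursionVolume μ T (ξ ω') | obsSigma ξ τ D U n]) ω) ^ 2 ∂P -
      ∫ ω, (excursionVolume μ T (ξ ω) -
        (P[fun ω' => excursionVolume μ T (ξ ω') | obsSigma ξ τ D U (n + 1)]) ω) ^ 2 ∂P +
      r ^ 2 + ε := by
  have hh := measurable_history hτ hξ hU hD n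
  have hα : Measurable fun ω => excursionVolume μ T (ξ ω) :=
    (measurable_excursionVolume μ T).comp hξ
  set A := P[fun ω' => excursionVolume μ T (ξ ω') | obsSigma ξ τ D U n] with hAdef
  have hA : ∀ᵐ ω ∂P, |A ω| ≤ μ.real Set.univ :=
    ae_abs_condExp_le fun ω => abs_excursionVolume_le μ T _
  have hAm : Measurable A := (stronglyMeasurable_condExp.mono hh.comap_le).measurable
  set R : Ω → ℝ := fun ω => excursionVolume μ T (ξ ω) - A ω with hRdef
  have hRm : Measurable R := hα.sub hAm
  have hRb : ∀ᵐ ω ∂P, |R ω| ≤ μ.real Set.univ + μ.real Set.univ := by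
    filter_upwards [hA] with ω hω
    exact (abs_sub _ _).trans (add_le_add (abs_excursionVolume_le μ T _) hω)
  have hRb' : ∀ᵐ q ∂(P.prod (gaussianReal 0 1)), |R q.1| ≤ μ.real Set.univ + μ.real Set.univ :=
    Measure.quasiMeasurePreserving_fst.ae hRb
  have hz : Measurable fun q : Ω × ℝ => ψ (ξ q.1 x + τ x * q.2) :=
    hψ.comp ((measurable_noisyEval_apply x).comp
      ((hξ.comp measurable_fst).prodMk measurable_snd))
  have hR' : Measurable fun q : Ω × ℝ => R q.1 := hRm.comp measurable_fst
  have i1 : Integrable (fun q : Ω × ℝ => R q.1 ^ 2) (P.prod (gaussianReal 0 1)) := by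
    refine Integrable.of_bound (hR'.pow_const 2).aestronglyMeasurable
      ((μ.real Set.univ + μ.real Set.univ) ^ 2) ?_
    filter_upwards [hRb'] with q hq
    rw [Real.norm_eq_abs, abs_pow]
    exact pow_le_pow_left₀ (abs_nonneg _) hq 2
  have i2 : Integrable (fun q : Ω × ℝ => R q.1 * ψ (ξ q.1 x + τ x * q.2))
      (P.prod (gaussianReal 0 1)) := by
    refine Integrable.of_bound (hR'.mul hz).aestronglyMeasurable
      (μ.real Set.univ + μ.real Set.univ) ?_
    filter_upwards [hRb'] with q hq
    rw [Real.norm_eq_abs, abs_mul]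
    exact (mul_le_of_le_one_right (abs_nonneg _) (hψ1 _)).trans hq
  have hψsq : ∀ z, ψ z ^ 2 ≤ 1 := fun z => by
    rw [← sq_abs]; exact pow_le_one₀ (abs_nonneg _) (hψ1 z)
  have i3 : Integrable (fun q : Ω × ℝ => ψ (ξ q.1 x + τ x * q.2) ^ 2)
      (P.prod (gaussianReal 0 1)) := by
    refine Integrable.of_bound (hz.pow_const 2).aestronglyMeasurable 1 (.of_forall fun q => ?_)
    rw [Real.norm_eq_abs, abs_of_nonneg (sq_nonneg _)]
    exact hψsq _
  have hexp : ∫ q : Ω × ℝ, (R q.1 - r * ψ (ξ q.1 x + τ x * q.2)) ^ 2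
        ∂(P.prod (gaussianReal 0 1)) =
      ∫ ω, R ω ^ 2 ∂P - 2 * r * ∫ q : Ω × ℝ, R q.1 * ψ (ξ q.1 x + τ x * q.2)
        ∂(P.prod (gaussianReal 0 1)) +
      r ^ 2 * ∫ q : Ω × ℝ, ψ (ξ q.1 x + τ x * q.2) ^ 2 ∂(P.prod (gaussianReal 0 1)) := by
    have h1 : ∫ q : Ω × ℝ, R q.1 ^ 2 ∂(P.prod (gaussianReal 0 1)) = ∫ ω, R ω ^ 2 ∂P := by
      simpa using integral_fun_fst (μ := P) (ν := gaussianReal 0 1) (fun ω => R ω ^ 2)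
    rw [← h1, ← integral_const_mul, ← integral_const_mul, ← integral_sub i1 (i2.const_mul _)]
    refine Eq.trans ?_ (integral_add (i1.sub (i2.const_mul _)) (i3.const_mul _))
    refine integral_congr_ae (.of_forall fun q => ?_)
    ring
  have hψint : ∫ q : Ω × ℝ, ψ (ξ q.1 x + τ x * q.2) ^ 2 ∂(P.prod (gaussianReal 0 1)) ≤ 1 := by
    refine (integral_mono i3 (integrable_const 1) fun q => hψsq _).trans ?_
    simp
  have hchain := (ofReal_integral_sq_le_lintegral_samplingCriterion (μ := μ) (T := T) hτ hξ hU
    hU_law hU_indep hξU hD n).trans (lintegral_mono_ae hmin)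
  rw [lintegral_add_right _ measurable_const, lintegral_const, measure_univ, mul_one] at hchain
  have hchain' := hchain.trans
    (add_le_add (lintegral_samplingCriterion_le hξ n hh x hψ hψ1 r) le_rfl)
  rw [← ENNReal.ofReal_add (integral_nonneg fun q => sq_nonneg _) hε,
    ENNReal.ofReal_le_ofReal_iff (add_nonneg (integral_nonneg fun q => sq_nonneg _) hε)] at hchain'
  change _ ≤ ∫ q : Ω × ℝ, (R q.1 - r * ψ (ξ q.1 x + τ x * q.2)) ^ 2
    ∂(P.prod (gaussianReal 0 1)) + ε at hchain'
  rw [hexp] at hchain'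
  have h5 := mul_le_mul_of_nonneg_left hψint (sq_nonneg r)
  rw [mul_one] at h5
  change 2 * r * ∫ q : Ω × ℝ, R q.1 * ψ (ξ q.1 x + τ x * q.2) ∂(P.prod (gaussianReal 0 1)) ≤
    ∫ ω, R ω ^ 2 ∂P - _ + r ^ 2 + ε
  linarith

end Step

/-! ### Residuals in the limit -/

section Limit

variable {X Ω : Type*} [MetricSpace X] [CompactSpace X] [MeasurableSpace X] [BorelSpace X]
  [mΩ : MeasurableSpace Ω] {P : Measure Ω} [IsProbabilityMeasure P] {ξ : Ω → C(X, ℝ)}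
  {τ : X → ℝ} {U : ℕ → Ω → ℝ} {D : ℕ → Ω → X} {μ : Measure X} [IsFiniteMeasure μ] {T : ℝ}

/-- The observations made so far, as a filtration. -/
def obsFiltration (hh : ∀ n, Measurable (history ξ τ D U n)) : Filtration ℕ mΩ where
  seq := obsSigma ξ τ D U
  mono' := fun _ _ h => obsSigma_mono h
  le' := fun n => (hh n).comap_le

/-- In the limit, the residual of the excursion volume is orthogonal to every bounded function of
a fresh noisy observation at any point. -/
lemma integral_residual_mul_noisy_eq_zero (hτ : Measurable τ) (hξ : Measurable ξ)
    (hU : ∀ n, Measurable (U n)) (hU_law : ∀ n, P.map (U n) = gaussianReal 0 1)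
    (hU_indep : iIndepFun U P) (hξU : IndepFun ξ (fun ω n => U n ω) P)
    (hD : IsSequentialDesign ξ τ D U) {ε : ℕ → ℝ} (hε : ∀ n, 0 ≤ ε n)
    (hε0 : Tendsto ε atTop (𝓝 0)) {n₀ : ℕ} (x : X)
    (hmin : ∀ n ≥ n₀, ∀ᵐ ω ∂P,
      samplingCriterion P ξ τ D U (excursionVariance μ T) n (D n ω) ω ≤
        samplingCriterion P ξ τ D U (excursionVariance μ T) n x ω + ENNReal.ofReal (ε n))
    {ψ : ℝ → ℝ} (hψ : Measurable ψ) (hψ1 : ∀ z, |ψ z| ≤ 1) :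
    ∫ q : Ω × ℝ, (excursionVolume μ T (ξ q.1) -
        (P[fun ω' => excursionVolume μ T (ξ ω') | ⨆ n, obsSigma ξ τ D U n]) q.1) *
          ψ (ξ q.1 x + τ x * q.2) ∂(P.prod (gaussianReal 0 1)) = 0 := by
  have hh := measurable_history hτ hξ hU hD
  have hα : Measurable fun ω => excursionVolume μ T (ξ ω) :=
    (measurable_excursionVolume μ T).comp hξ
  set A : ℕ → Ω → ℝ := fun n => P[fun ω' => excursionVolume μ T (ξ ω') | obsSigma ξ τ D U n]
    with hAdef
  set B : Ω → ℝ := P[fun ω' => excursionVolume μ T (ξ ω') | ⨆ n, obsSigma ξ τ D U n] with hBdef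
  set V : ℕ → ℝ := fun n => ∫ ω, (excursionVolume μ T (ξ ω) - A n ω) ^ 2 ∂P with hVdef
  have hA : ∀ n, ∀ᵐ ω ∂P, |A n ω| ≤ μ.real Set.univ := fun n =>
    ae_abs_condExp_le fun ω => abs_excursionVolume_le μ T _
  have hAm : ∀ n, Measurable (A n) := fun n =>
    (stronglyMeasurable_condExp.mono (hh n).comap_le).measurable
  have hVanti : Antitone V := by
    refine antitone_nat_of_succ_le fun n => ?_
    exact integral_sq_sub_condExp_le (hh (n + 1)).comap_le hα
      (fun ω => abs_excursionVolume_le μ T _)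
      (stronglyMeasurable_condExp.mono (obsSigma_mono n.le_succ)) (hA n)
  have hVlim : Tendsto (fun n => V n - V (n + 1)) atTop (𝓝 0) := by
    have hbdd : BddBelow (Set.range V) :=
      ⟨0, by rintro _ ⟨n, rfl⟩; exact integral_nonneg fun ω => sq_nonneg _⟩
    have h := tendsto_atTop_ciInf hVanti hbdd
    simpa using h.sub (h.comp (tendsto_add_atTop_nat 1))
  have hconv : ∀ᵐ ω ∂P, Tendsto (fun n => A n ω) atTop (𝓝 (B ω)) :=
    tendsto_ae_condExp (ℱ := obsFiltration hh) _
  have hlim : ∀ {φ : ℝ → ℝ}, Measurable φ → (∀ z, |φ z| ≤ 1) →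
      Tendsto (fun n => ∫ q : Ω × ℝ, (excursionVolume μ T (ξ q.1) - A n q.1) *
          φ (ξ q.1 x + τ x * q.2) ∂(P.prod (gaussianReal 0 1))) atTop
        (𝓝 (∫ q : Ω × ℝ, (excursionVolume μ T (ξ q.1) - B q.1) *
          φ (ξ q.1 x + τ x * q.2) ∂(P.prod (gaussianReal 0 1)))) := by
    intro φ hφ hφ1
    have hz : Measurable fun q : Ω × ℝ => φ (ξ q.1 x + τ x * q.2) :=
      hφ.comp ((measurable_noisyEval_apply x).comp
        ((hξ.comp measurable_fst).prodMk measurable_snd))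
    refine tendsto_integral_of_dominated_convergence
      (fun _ => μ.real Set.univ + μ.real Set.univ)
      (fun n => (((hα.sub (hAm n)).comp measurable_fst).mul hz).aestronglyMeasurable)
      (integrable_const _) (fun n => ?_) ?_
    · filter_upwards [Measure.quasiMeasurePreserving_fst.ae (hA n)] with q hq
      rw [Real.norm_eq_abs, abs_mul]
      exact (mul_le_of_le_one_right (abs_nonneg _) (hφ1 _)).trans
        ((abs_sub _ _).trans (add_le_add (abs_excursionVolume_le μ T _) hq))
    · filter_upwards [Measure.quasiMeasurePreserving_fst.ae hconv] with q hq
      exact (hq.const_sub _).mul_const _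
  -- The quadratic term `r ^ 2` is negligible against the linear one as `r` decreases to zero.
  have hle : ∀ {φ : ℝ → ℝ}, Measurable φ → (∀ z, |φ z| ≤ 1) →
      ∫ q : Ω × ℝ, (excursionVolume μ T (ξ q.1) - B q.1) *
          φ (ξ q.1 x + τ x * q.2) ∂(P.prod (gaussianReal 0 1)) ≤ 0 := by
    intro φ hφ hφ1
    refine le_of_forall_pos_le_add fun r hr => ?_
    have h := le_of_tendsto_of_tendsto ((hlim hφ hφ1).const_mul (2 * r))
      ((hVlim.add_const (r ^ 2)).add hε0) (by
        filter_upwards [eventually_ge_atTop n₀] with n hn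
        exact two_mul_residual_correlation_le hτ hξ hU hU_law hU_indep hξU hD n (hε n) x
          (hmin n hn) hφ hφ1 r)
    nlinarith
  refine le_antisymm (hle hψ hψ1) ?_
  have h := hle hψ.neg (fun z => by simpa using hψ1 z)
  simpa [integral_neg] using h

/-- A random variable which is orthogonal to each indicator of `{T ≤ ξ x}` is orthogonal to
their integral over `x`, which is the excursion volume itself. -/
lemma integral_mul_excursionVolume_eq_zero (hξ : Measurable ξ) {R : Ω → ℝ} {C : ℝ}
    (hR : Measurable R) (hRC : ∀ᵐ ω ∂P, |R ω| ≤ C)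
    (h : ∀ x, ∫ ω in {ω | T ≤ ξ ω x}, R ω ∂P = 0) :
    ∫ ω, R ω * excursionVolume μ T (ξ ω) ∂P = 0 := by
  have hs : MeasurableSet {q : Ω × X | T ≤ ξ q.1 q.2} :=
    measurableSet_le measurable_const
      (measurable_eval.comp ((hξ.comp measurable_fst).prodMk measurable_snd))
  have hi : Integrable (fun q : Ω × X => {q : Ω × X | T ≤ ξ q.1 q.2}.indicator
      (fun q => R q.1) q) (P.prod μ) := by
    refine Integrable.indicator ?_ hs
    exact Integrable.of_bound (hR.comp measurable_fst).aestronglyMeasurable C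
      (Measure.quasiMeasurePreserving_fst.ae hRC)
  calc ∫ ω, R ω * excursionVolume μ T (ξ ω) ∂P
      = ∫ ω, ∫ x, {q : Ω × X | T ≤ ξ q.1 q.2}.indicator (fun q => R q.1) (ω, x) ∂μ ∂P := by
        refine integral_congr_ae (.of_forall fun ω => ?_)
        have hsω : MeasurableSet {x | T ≤ ξ ω x} :=
          measurableSet_le measurable_const (ξ ω).continuous.measurable
        change R ω * μ.real {x | T ≤ ξ ω x} = ∫ x, {x | T ≤ ξ ω x}.indicator (fun _ => R ω) x ∂μ
        rw [integral_indicator_const _ hsω, smul_eq_mul, mul_comm]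
    _ = ∫ x, ∫ ω, {q : Ω × X | T ≤ ξ q.1 q.2}.indicator (fun q => R q.1) (ω, x) ∂P ∂μ :=
        integral_integral_swap hi
    _ = ∫ x, (0 : ℝ) ∂μ := by
        refine integral_congr_ae (.of_forall fun x => ?_)
        have hsx : MeasurableSet {ω | T ≤ ξ ω x} :=
          measurableSet_le measurable_const
            (measurable_eval.comp (hξ.prodMk measurable_const))
        refine Eq.trans ?_ (h x)
        exact integral_indicator hsx
    _ = 0 := by simp

/-- The excursion volume is almost surely determined by the whole sequence of observations. -/
lemma excursionVolume_ae_eq_condExp (hτ : Measurable τ) (hξ : Measurable ξ)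
    (hU : ∀ n, Measurable (U n)) (hU_law : ∀ n, P.map (U n) = gaussianReal 0 1)
    (hU_indep : iIndepFun U P) (hξU : IndepFun ξ (fun ω n => U n ω) P)
    (hD : IsSequentialDesign ξ τ D U) {ε : ℕ → ℝ} (hε : ∀ n, 0 ≤ ε n)
    (hε0 : Tendsto ε atTop (𝓝 0)) {n₀ : ℕ}
    (hmin : ∀ n ≥ n₀, ∀ᵐ ω ∂P, ∀ x,
      samplingCriterion P ξ τ D U (excursionVariance μ T) n (D n ω) ω ≤
        samplingCriterion P ξ τ D U (excursionVariance μ T) n x ω + ENNReal.ofReal (ε n)) :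
    P[fun ω => excursionVolume μ T (ξ ω) | ⨆ n, obsSigma ξ τ D U n] =ᵐ[P]
      fun ω => excursionVolume μ T (ξ ω) := by
  have hh := measurable_history hτ hξ hU hD
  have hα : Measurable fun ω => excursionVolume μ T (ξ ω) :=
    (measurable_excursionVolume μ T).comp hξ
  have hle : (⨆ n, obsSigma ξ τ D U n) ≤ mΩ := iSup_le fun n => (hh n).comap_le
  set B : Ω → ℝ := P[fun ω => excursionVolume μ T (ξ ω) | ⨆ n, obsSigma ξ τ D U n] with hBdef
  have hB : ∀ᵐ ω ∂P, |B ω| ≤ μ.real Set.univ :=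
    ae_abs_condExp_le fun ω => abs_excursionVolume_le μ T _
  have hB0 : ∀ᵐ ω ∂P, 0 ≤ B ω :=
    condExp_nonneg (.of_forall fun ω => excursionVolume_nonneg μ T _)
  have hBm : Measurable B := (stronglyMeasurable_condExp.mono hle).measurable
  set R : Ω → ℝ := fun ω => excursionVolume μ T (ξ ω) - B ω with hRdef
  have hRm : Measurable R := hα.sub hBm
  have hRb : ∀ᵐ ω ∂P, |R ω| ≤ μ.real Set.univ + μ.real Set.univ := by
    filter_upwards [hB] with ω hω
    exact (abs_sub _ _).trans (add_le_add (abs_excursionVolume_le μ T _) hω)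
  have hαi : Integrable (fun ω => excursionVolume μ T (ξ ω)) P :=
    integrable_of_bound hα fun ω => abs_excursionVolume_le μ T _
  have hBi : Integrable B P := integrable_condExp
  have hev : ∀ x, Measurable fun ω => ξ ω x := fun x =>
    measurable_eval.comp (hξ.prodMk measurable_const)
  have hchar : ∀ (x : X) (t : ℝ),
      ∫ ω, (R ω : ℂ) * Complex.exp (t * ξ ω x * Complex.I) ∂P = 0 := by
    intro x t
    refine integral_mul_exp_eq_zero_of_noisy (c := τ x) hRm hRb (hev x) (fun ψ hψ hψ1 => ?_) t
    refine integral_residual_mul_noisy_eq_zero (n₀ := n₀) hτ hξ hU hU_law hU_indep hξU hD hε hε0 x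
      (fun n hn => ?_) hψ hψ1
    filter_upwards [hmin n hn] with ω hω using hω x
  have hset : ∀ x, ∫ ω in {ω | T ≤ ξ ω x}, R ω ∂P = 0 := by
    intro x
    have h := setIntegral_eq_of_charFun_eq (C := μ.real Set.univ) hα hBm
      (.of_forall fun ω => excursionVolume_nonneg μ T _) hB0
      (.of_forall fun ω => excursionVolume_le μ T _)
      (by filter_upwards [hB] with ω hω using (le_abs_self _).trans hω) (hev x) (fun t => ?_) T
    · rw [hRdef, integral_sub hαi.integrableOn hBi.integrableOn, h, sub_self]
    · have hexp : ∀ {c : Ω → ℝ}, Integrable c P →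
          Integrable (fun ω => (c ω : ℂ) * Complex.exp (t * ξ ω x * Complex.I)) P := by
        intro c hc
        refine hc.ofReal.mul_bdd (c := 1) ?_ (.of_forall fun ω => ?_)
        · have := hev x
          exact Measurable.aestronglyMeasurable (by fun_prop)
        · rw [← Complex.ofReal_mul, Complex.norm_exp_ofReal_mul_I]
      rw [← sub_eq_zero, ← integral_sub (hexp hαi) (hexp hBi), ← hchar x t]
      refine integral_congr_ae (.of_forall fun ω => ?_)
      simp only [hRdef]; push_cast; ring
  -- The residual `R = α(ξ) - B` is orthogonal to `α(ξ)` and to `B`, hence to itself.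
  have h1 : ∫ ω, R ω * excursionVolume μ T (ξ ω) ∂P = 0 :=
    integral_mul_excursionVolume_eq_zero hξ hRm hRb hset
  have h2 : ∫ ω, R ω * B ω ∂P = 0 :=
    integral_sub_condExp_mul_eq_zero hle hα (fun ω => abs_excursionVolume_le μ T _)
      stronglyMeasurable_condExp hB
  have hRi : Integrable R P := hαi.sub hBi
  have i1 : Integrable (fun ω => R ω * excursionVolume μ T (ξ ω)) P :=
    hRi.mul_bdd hα.aestronglyMeasurable (.of_forall fun ω => abs_excursionVolume_le μ T _)
  have i2 : Integrable (fun ω => R ω * B ω) P := hRi.mul_bdd hBm.aestronglyMeasurable hB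
  have hsq : (fun ω => R ω ^ 2) =
      fun ω => R ω * excursionVolume μ T (ξ ω) - R ω * B ω := by
    funext ω; simp only [hRdef]; ring
  have h3 : ∫ ω, R ω ^ 2 ∂P = 0 := by
    rw [hsq, integral_sub i1 i2, h1, h2, sub_zero]
  rw [integral_eq_zero_iff_of_nonneg (fun ω => sq_nonneg _) (hsq ▸ i1.sub i2)] at h3
  filter_upwards [h3] with ω hω
  exact (sub_eq_zero.1 (pow_eq_zero_iff two_ne_zero |>.1 hω)).symm

end Limit

end SUR

theorem mainTheorem8 {X Ω : Type*} [MetricSpace X] [CompactSpace X] [MeasurableSpace X]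
    [BorelSpace X] [MeasurableSpace Ω] (P : Measure Ω) [IsProbabilityMeasure P]
    (ξ : Ω → C(X, ℝ)) (hξ_meas : ∀ x, Measurable (fun ω => ξ ω x))
    (hξ : IsGaussianProcess (fun (x : X) (ω : Ω) => ξ ω x) P)
    (τ : X → ℝ) (hτ_cont : Continuous τ) (hτ_nonneg : ∀ x, 0 ≤ τ x)
    (U : ℕ → Ω → ℝ) (hU_meas : ∀ n, Measurable (U n))
    (hU_law : ∀ n, P.map (U n) = gaussianReal 0 1) (hU_indep : iIndepFun U P)
    (hξU : IndepFun ξ (fun ω n => U n ω) P)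
    (μ : Measure X) [IsFiniteMeasure μ] (T : ℝ) (D : ℕ → Ω → X)
    (hD : SUR.IsSURDesign P ξ τ D U (SUR.excursionVariance μ T) ∨
      ∃ ε : ℕ → ℝ, SUR.IsQuasiSURDesign P ξ τ D U (SUR.excursionVariance μ T) ε) :
    (∀ᵐ ω ∂P, Tendsto
        (fun n => (P[fun ω' => SUR.excursionVolume μ T (ξ ω') | SUR.obsSigma ξ τ D U n]) ω)
        atTop (𝓝 (SUR.excursionVolume μ T (ξ ω)))) ∧
      Tendsto
        (fun n => eLpNorm
          (fun ω => (P[fun ω' => SUR.excursionVolume μ T (ξ ω') | SUR.obsSigma ξ τ D U n]) ω -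
            SUR.excursionVolume μ T (ξ ω)) 1 P)
        atTop (𝓝 0) := by
  have hτ := hτ_cont.measurable
  have hξm := SUR.measurable_continuousMap_of_eval hξ_meas
  obtain ⟨hseq, ε, hε, hε0, n₀, hmin⟩ := SUR.exists_almost_minimizing hD
  have hh := SUR.measurable_history hτ hξm hU_meas hseq
  have hB := SUR.excursionVolume_ae_eq_condExp hτ hξm hU_meas hU_law hU_indep hξU hseq hε hε0 hmin
  constructor
  · have hconv := tendsto_ae_condExp (μ := P) (ℱ := SUR.obsFiltration hh)
      (fun ω => SUR.excursionVolume μ T (ξ ω))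
    filter_upwards [hconv, hB] with ω h1 h2
    exact h2 ▸ h1
  · have hconv := tendsto_eLpNorm_condExp (μ := P) (ℱ := SUR.obsFiltration hh)
      (fun ω => SUR.excursionVolume μ T (ξ ω))
    refine hconv.congr fun n => eLpNorm_congr_ae ?_
    filter_upwards [hB] with ω h2
    exact congrArg (_ - ·) h2
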